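/- Let $(X,d)$ be a complete metric space and let $(S(t))_{t\ge 0}$ be a dynamical system on $X$, i.e. a family of maps $S(t):X\to X$ such that each $S(t)$ is continuous, $S(0)x=x$ for all $x\in X$, $S(t+s)=S(t)\circ S(s)$ for all $s,t\ge 0$, and $t\mapsto S(t)x$ is continuous on $\mathbb R^+:=[0,+\infty)$ for every $x\in X$. A positive trajectory is a map $u:\mathbb R^+\to X$ of the form $u(t)=S(t)x$ for some $x\in X$; a complete trajectory is a map $v:\mathbb R\to X$ with $v(t+\tau)=S(\tau)v(t)$ for all $t\in\mathbb R$, $\tau\ge 0$. A function $u$ on $\mathbb R^+$ (resp. on $\mathbb R$) is periodic if there is $\omega>0$ with $u(t+\omega)=u(t)$ for all $t\ge 0$ (resp. all $t\in\mathbb R$). $(S(t))_{t\ge0}$ is equicontinuous on a set $K\subset X$ if for every $\varepsilon>0$ there is $\delta>0$ such that for all $x_1,x_2\in K$, $d(x_1,x_2)\le\delta$ implies $\sup_{t\ge 0}d(S(t)x_1,S(t)x_2)\le\varepsilon$. Assume that $(S(t))_{t\ge 0}$ has the backward uniqueness property: any two positive trajectories having the same value at some $t_0\ge 0$ coincide at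 every $t\ge 0$. Then: i) If $u$ is a positive trajectory, then $u$ is periodic on $\mathbb R^+$ if and only if $u(\mathbb R^+)$ is a compact set and $(S(t))_{t\ge 0}$ is equicontinuous on $u(\mathbb R^+)$. In this case there is a periodic complete trajectory $v$ whose restriction to $\mathbb R^+$ is $u$. ii) If $v$ is a complete trajectory, then $v$ is periodic if and only if $v(\mathbb R^+)$ is a compact set and $(S(t))_{t\ge 0}$ is equicontinuous on $v(\mathbb R^+)$. -/

import Mathlib

open scoped NNReal

/-- A dynamical system (nonlinear semigroup) on a metric space `X`: a one-parameter family
`(S t)` for `t ≥ 0` of continuous self-maps with `S 0 = id`, `S (t + s) = S t ∘ S s`, and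
`t ↦ S t x` continuous for every `x`. (Only separate continuity is required, so this is weaker
than Mathlib's `Flow ℝ≥0 X`.) -/
structure DynamicalSystem (X : Type*) [MetricSpace X] where
  S : ℝ≥0 → X → X
  continuous_map : ∀ t, Continuous (S t)
  map_zero : ∀ x, S 0 x = x
  map_add : ∀ s t x, S (t + s) x = S t (S s x)
  continuous_orbit : ∀ x, Continuous fun t => S t x

namespace DynamicalSystem

variable {X : Type*} [MetricSpace X] (D : DynamicalSystem X)

/-- `u : ℝ⁺ → X` is a positive trajectory: `u = S(·)x` for some `x`. -/
def IsPositiveTrajectory (u : ℝ≥0 → X) : Prop :=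
  ∃ x, u = fun t => D.S t x

/-- `v : ℝ → X` is a complete trajectory: `v (t + τ) = S(τ) v(t)` for all real `t` and `τ ≥ 0`. -/
def IsCompleteTrajectory (v : ℝ → X) : Prop :=
  ∀ (t : ℝ) (τ : ℝ≥0), v (t + τ) = D.S τ (v t)

/-- The family `(S t)`, `t ≥ 0`, is (uniformly) equicontinuous on the set `K`. -/
def EquicontinuousOnSet (K : Set X) : Prop :=
  ∀ ε > (0 : ℝ), ∃ δ > (0 : ℝ), ∀ x₁ ∈ K, ∀ x₂ ∈ K, dist x₁ x₂ ≤ δ →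
    ∀ t : ℝ≥0, dist (D.S t x₁) (D.S t x₂) ≤ ε

/-- Two positive trajectories that agree at one time agree at all times. -/
def BackwardUniqueness : Prop :=
  ∀ u₁ u₂ : ℝ≥0 → X, D.IsPositiveTrajectory u₁ → D.IsPositiveTrajectory u₂ →
    ∀ t₀ : ℝ≥0, u₁ t₀ = u₂ t₀ → ∀ t : ℝ≥0, u₁ t = u₂ t

end DynamicalSystem

/-- A function on `ℝ⁺` is periodic: it has some period `ω > 0`. -/
def IsPeriodicOnNonneg {X : Type*} (u : ℝ≥0 → X) : Prop :=
  ∃ ω : ℝ≥0, 0 < ω ∧ ∀ t : ℝ≥0, u (t + ω) = u t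

/-- A function on `ℝ` is periodic: it has some period `ω > 0`. -/
def IsPeriodicOnReal {X : Type*} (v : ℝ → X) : Prop :=
  ∃ ω : ℝ, 0 < ω ∧ ∀ t : ℝ, v (t + ω) = v t

/-- The positive trajectory `u` is the restriction to `ℝ⁺` of a periodic complete trajectory. -/
def DynamicalSystem.IsExtendableToPeriodic {X : Type*} [MetricSpace X] (D : DynamicalSystem X)
    (u : ℝ≥0 → X) : Prop :=
  ∃ v : ℝ → X, D.IsCompleteTrajectory v ∧ IsPeriodicOnReal v ∧ ∀ t : ℝ≥0, v t = u t

namespace IsPeriodicOnNonneg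

variable {X : Type*} {u : ℝ≥0 → X} {ω : ℝ≥0}

/-! Compactness of the range forces a return. Along an ultrafilter finer than `atTop`, `u t` tends
to some `u s` and `u (t - (s + 1))` to some `u r`; continuity of `S (s + 1)` gives `u s = u (s + 1 +
r)`, and backward uniqueness spreads this coincidence to all times. Conversely, a periodic orbit is
the image of `[0, ω]`, and equicontinuity on it reduces to compactness of `[0, ω]³`. For complete
trajectories, backward uniqueness carries periodicity to negative times. -/

theorem apply_add_nat_mul (h : ∀ t, u (t + ω) = u t) (n : ℕ) (t : ℝ≥0) :
    u (t + n * ω) = u t := by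
  induction n with
  | zero => simp
  | succ n ih => rw [Nat.cast_succ, add_mul, one_mul, ← add_assoc, h, ih]

/-- One `s` serves all shifts `r`, so the two times in `u (t + r)` can be reduced modulo `ω`
independently. -/
theorem exists_mem_Icc_forall_add_eq (hω : 0 < ω) (h : ∀ t, u (t + ω) = u t) (t : ℝ≥0) :
    ∃ s ∈ Set.Icc 0 ω, ∀ r, u (t + r) = u (s + r) := by
  have hle : (⌊t / ω⌋₊ : ℝ≥0) * ω ≤ t := by
    rw [← le_div_iff₀ hω]
    exact Nat.floor_le zero_le
  have hlt : t ≤ ω + ⌊t / ω⌋₊ * ω := by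
    have := (div_lt_iff₀ hω).1 (Nat.lt_floor_add_one (t / ω))
    rw [add_mul, one_mul, add_comm] at this
    exact this.le
  refine ⟨t - ⌊t / ω⌋₊ * ω, ⟨zero_le, tsub_le_iff_right.2 hlt⟩, fun r => ?_⟩
  rw [← apply_add_nat_mul h ⌊t / ω⌋₊ (t - ⌊t / ω⌋₊ * ω + r), add_right_comm,
    tsub_add_cancel_of_le hle]

theorem range_eq_image_Icc (hω : 0 < ω) (h : ∀ t, u (t + ω) = u t) :
    Set.range u = u '' Set.Icc 0 ω := by
  refine Set.Subset.antisymm ?_ (Set.image_subset_range _ _)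
  rintro _ ⟨t, rfl⟩
  obtain ⟨s, hs, hts⟩ := exists_mem_Icc_forall_add_eq hω h t
  exact ⟨s, hs, by simpa using (hts 0).symm⟩

/-- The extension to `ℝ` of a function on `ℝ⁺` with period `ω`. -/
noncomputable def periodicExtension (u : ℝ≥0 → X) (ω : ℝ≥0) (t : ℝ) : X :=
  u (t + ⌈|t| / ω⌉₊ * ω).toNNReal

/-- The value does not depend on how many periods are added, so identities can be checked with any
convenient `n`. -/
theorem periodicExtension_eq (hω : 0 < ω) (h : ∀ t, u (t + ω) = u t) {t : ℝ} {n : ℕ}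
    (hn : 0 ≤ t + n * ω) : periodicExtension u ω t = u (t + n * ω).toNNReal := by
  have key : ∀ {k m : ℕ}, k ≤ m → 0 ≤ t + k * ω →
      u (t + m * ω).toNNReal = u (t + k * ω).toNNReal := by
    intro k m hkm hk
    obtain ⟨j, rfl⟩ := Nat.exists_eq_add_of_le hkm
    rw [← apply_add_nat_mul h j (t + k * ω).toNNReal]
    congr 1
    have hj : (0 : ℝ) ≤ j * ω := by positivity
    apply NNReal.coe_injective
    push_cast
    rw [Real.coe_toNNReal _ hk, Real.coe_toNNReal _ (by linarith)]
    ring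
  have hceil : 0 ≤ t + (⌈|t| / ω⌉₊ : ℝ) * ω := by
    have := (div_le_iff₀ (NNReal.coe_pos.2 hω)).1 (Nat.le_ceil (|t| / (ω : ℝ)))
    linarith [neg_abs_le t]
  rcases le_total ⌈|t| / (ω : ℝ)⌉₊ n with hle | hle
  · exact (key hle hceil).symm
  · exact key hle hn

end IsPeriodicOnNonneg

namespace DynamicalSystem

open Filter Topology IsPeriodicOnNonneg

variable {X : Type*} [MetricSpace X] {D : DynamicalSystem X} {u : ℝ≥0 → X} {v : ℝ → X}

theorem IsPositiveTrajectory.apply_add (hu : D.IsPositiveTrajectory u) (s t : ℝ≥0) :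
    u (s + t) = D.S s (u t) := by
  obtain ⟨x, rfl⟩ := hu
  exact D.map_add t s x

theorem IsPositiveTrajectory.continuous (hu : D.IsPositiveTrajectory u) : Continuous u := by
  obtain ⟨x, rfl⟩ := hu
  exact D.continuous_orbit x

theorem IsPositiveTrajectory.isCompact_range (hu : D.IsPositiveTrajectory u)
    (hp : IsPeriodicOnNonneg u) : IsCompact (Set.range u) := by
  obtain ⟨ω, hω, h⟩ := hp
  rw [range_eq_image_Icc hω h]
  exact isCompact_Icc.image hu.continuous

theorem IsPositiveTrajectory.equicontinuousOnSet_range (hu : D.IsPositiveTrajectory u)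
    (hp : IsPeriodicOnNonneg u) : D.EquicontinuousOnSet (Set.range u) := by
  obtain ⟨ω, hω, h⟩ := hp
  intro ε hε
  have hc := hu.continuous
  -- The bad triples: base times `a`, `b` whose orbits are at least `ε` apart after time `c`. On
  -- this compact set `u a ≠ u b`, so their distance has a positive lower bound.
  let F : Set (ℝ≥0 × ℝ≥0 × ℝ≥0) := (Set.Icc 0 ω ×ˢ Set.Icc 0 ω ×ˢ Set.Icc 0 ω) ∩
    {p | ε ≤ dist (u (p.1 + p.2.2)) (u (p.2.1 + p.2.2))}
  have hF : IsCompact F :=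
    (isCompact_Icc.prod (isCompact_Icc.prod isCompact_Icc)).inter_right
      (isClosed_le continuous_const (by fun_prop))
  obtain ⟨δ, hδ, hFδ⟩ : ∃ δ > (0 : ℝ), ∀ p ∈ F, δ < dist (u p.1) (u p.2.1) := by
    -- Halving the bound makes it strict, as the condition `dist ≤ δ` requires.
    refine hF.exists_forall_le' (f := fun p => dist (u p.1) (u p.2.1)) (a := 0)
      (by fun_prop) (fun p hp => ?_) |>.imp' (· / 2) fun b hb => ⟨half_pos hb.1, fun p hp =>
        (half_lt_self hb.1).trans_le (hb.2 p hp)⟩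
    refine dist_pos.2 fun heq => ?_
    have : ε ≤ dist (u (p.1 + p.2.2)) (u (p.2.1 + p.2.2)) := hp.2
    rw [add_comm p.1, add_comm p.2.1, hu.apply_add, hu.apply_add, heq, dist_self] at this
    exact absurd this hε.not_ge
  refine ⟨δ, hδ, ?_⟩
  rintro _ ⟨s₁, rfl⟩ _ ⟨s₂, rfl⟩ hd t
  obtain ⟨a, ha, hsa⟩ := exists_mem_Icc_forall_add_eq hω h s₁
  obtain ⟨b, hb, hsb⟩ := exists_mem_Icc_forall_add_eq hω h s₂
  obtain ⟨c, hc, htc⟩ := exists_mem_Icc_forall_add_eq hω h t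
  have ha0 := hsa 0
  have hb0 := hsb 0
  simp only [add_zero] at ha0 hb0
  rw [← hu.apply_add, ← hu.apply_add, htc, htc, add_comm c, add_comm c, hsa, hsb]
  by_contra! hlt
  refine (hFδ (a, b, c) ⟨⟨ha, hb, hc⟩, hlt.le⟩).not_ge ?_
  simpa only [← ha0, ← hb0] using hd

theorem BackwardUniqueness.isPeriodicOnNonneg_of_apply_eq (hD : D.BackwardUniqueness)
    (hu : D.IsPositiveTrajectory u) {s ω : ℝ≥0} (hω : 0 < ω) (h : u (s + ω) = u s) :
    IsPeriodicOnNonneg u :=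
  ⟨ω, hω, hD (fun t => u (t + ω)) u ⟨u ω, funext fun t => hu.apply_add t ω⟩ hu s h⟩

/-- A trajectory with compact range returns to one of its points: every point of the omega-limit
set has preimages in the range under all `S t`. -/
theorem IsPositiveTrajectory.exists_apply_add_eq (hu : D.IsPositiveTrajectory u)
    (hK : IsCompact (Set.range u)) : ∃ s ω : ℝ≥0, 0 < ω ∧ u (s + ω) = u s := by
  let U : Ultrafilter ℝ≥0 := Ultrafilter.of atTop
  have hU : (U : Filter ℝ≥0) ≤ atTop := Ultrafilter.of_le atTop
  have hlim : ∀ f : ℝ≥0 → ℝ≥0, ∃ r, Tendsto (fun t => u (f t)) U (𝓝 (u r)) := by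
    intro f
    obtain ⟨_, ⟨r, rfl⟩, hr⟩ := hK.ultrafilter_le_nhds (U.map fun t => u (f t))
      (tendsto_principal.2 (Filter.Eventually.of_forall fun t => ⟨f t, rfl⟩))
    exact ⟨r, hr⟩
  obtain ⟨s, hs⟩ := hlim id
  -- The extra `1` makes the return time `1 + r` positive even if `r = 0`. Truncated subtraction is
  -- harmless, since eventually `s + 1 ≤ t`.
  obtain ⟨r, hr⟩ := hlim fun t => t - (s + 1)
  refine ⟨s, 1 + r, by positivity, ?_⟩
  rw [← add_assoc, hu.apply_add]
  refine tendsto_nhds_unique (((D.continuous_map (s + 1)).tendsto _).comp hr) (hs.congr' ?_)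
  filter_upwards [hU (eventually_ge_atTop (s + 1))] with t ht
  rw [Function.comp_apply, ← hu.apply_add, add_tsub_cancel_of_le ht, id]

theorem IsPositiveTrajectory.isExtendableToPeriodic (hu : D.IsPositiveTrajectory u)
    (hp : IsPeriodicOnNonneg u) : D.IsExtendableToPeriodic u := by
  obtain ⟨ω, hω, h⟩ := hp
  have hω' : (0 : ℝ) < ω := NNReal.coe_pos.2 hω
  have hbound : ∀ t : ℝ, ∃ n : ℕ, 0 ≤ t + n * ω := by
    intro t
    obtain ⟨n, hn⟩ := exists_nat_ge (-t / ω)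
    exact ⟨n, by linarith [(div_le_iff₀ hω').1 hn]⟩
  refine ⟨periodicExtension u ω, fun t τ => ?_, ⟨ω, hω', fun t => ?_⟩, fun t => ?_⟩
  · obtain ⟨n, hn⟩ := hbound t
    have hτ := τ.coe_nonneg
    rw [periodicExtension_eq hω h hn, periodicExtension_eq hω h (n := n) (by linarith),
      ← hu.apply_add, add_right_comm, Real.toNNReal_add hn hτ, Real.toNNReal_coe, add_comm]
  · obtain ⟨n, hn⟩ := hbound t
    have hn' : t + ω + n * ω = t + (n + 1 : ℕ) * ω := by push_cast; ring
    rw [periodicExtension_eq hω h (n := n) (by linarith),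
      periodicExtension_eq hω h (n := n + 1) (by linarith), hn']
  · rw [periodicExtension_eq hω h (n := 0) (by simp)]
    simp

theorem IsCompleteTrajectory.isPositiveTrajectory (hv : D.IsCompleteTrajectory v) (t : ℝ) :
    D.IsPositiveTrajectory fun τ : ℝ≥0 => v (t + τ) :=
  ⟨v t, funext (hv t)⟩

theorem BackwardUniqueness.isPeriodicOnReal_iff (hD : D.BackwardUniqueness)
    (hv : D.IsCompleteTrajectory v) :
    IsPeriodicOnReal v ↔ IsPeriodicOnNonneg fun t : ℝ≥0 => v t := by
  constructor
  · rintro ⟨ω, hω, h⟩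
    exact ⟨⟨ω, hω.le⟩, hω, fun t => h t⟩
  · rintro ⟨ω, hω, h⟩
    refine ⟨ω, NNReal.coe_pos.2 hω, fun t => ?_⟩
    rcases le_total 0 t with ht | ht
    · exact h ⟨t, ht⟩
    · have h0 := h 0
      simp only [zero_add, NNReal.coe_zero] at h0
      have ht' : t + (-t).toNNReal = 0 := by
        rw [Real.coe_toNNReal _ (neg_nonneg.2 ht), add_neg_cancel]
      -- The trajectories issued from `v (t + ω)` and `v t` meet after time `-t`, at `v ω = v 0`, so
      -- they already agree at time `0`.
      have := hD _ _ (hv.isPositiveTrajectory (t + ω)) (hv.isPositiveTrajectory t)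
        (-t).toNNReal (by simpa only [add_right_comm t (ω : ℝ), ht', zero_add] using h0) 0
      simpa using this

end DynamicalSystem

theorem corollary5p4 {X : Type*} [MetricSpace X] [CompleteSpace X] (D : DynamicalSystem X)
    (hD : D.BackwardUniqueness) :
    (∀ u : ℝ≥0 → X, D.IsPositiveTrajectory u →
      (IsPeriodicOnNonneg u ↔
        IsCompact (Set.range u) ∧ D.EquicontinuousOnSet (Set.range u)) ∧
      (IsPeriodicOnNonneg u → D.IsExtendableToPeriodic u)) ∧
    (∀ v : ℝ → X, D.IsCompleteTrajectory v →
      (IsPeriodicOnReal v ↔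
        IsCompact (v '' Set.Ici 0) ∧ D.EquicontinuousOnSet (v '' Set.Ici 0))) := by
  have main : ∀ u : ℝ≥0 → X, D.IsPositiveTrajectory u → (IsPeriodicOnNonneg u ↔
      IsCompact (Set.range u) ∧ D.EquicontinuousOnSet (Set.range u)) := by
    refine fun u hu => ⟨fun hp => ⟨hu.isCompact_range hp, hu.equicontinuousOnSet_range hp⟩,
      fun hK => ?_⟩
    obtain ⟨s, ω, hω, h⟩ := hu.exists_apply_add_eq hK.1
    exact hD.isPeriodicOnNonneg_of_apply_eq hu hω h
  refine ⟨fun u hu => ⟨main u hu, hu.isExtendableToPeriodic⟩, fun v hv => ?_⟩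
  have hrange : v '' Set.Ici 0 = Set.range fun t : ℝ≥0 => v t := by
    rw [Set.image_eq_range]
    rfl
  rw [hD.isPeriodicOnReal_iff hv, hrange]
  exact main _ (by simpa using hv.isPositiveTrajectory 0)
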